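/- Let $A\in\mathbb R^{n\times n}$, $B\in\mathbb R^{n\times m}$ with $(A,B)$ controllable, and let $H=\begin{pmatrix}Q&S^\top\\S&R\end{pmatrix}$ be a symmetric (possibly indefinite) matrix that is strictly pre-dissipative, i.e. there is a symmetric $\Lambda$ with $$\begin{pmatrix}Q+\Lambda-A^\top\Lambda A & S^\top-A^\top\Lambda B\\ S-B^\top\Lambda A & R-B^\top\Lambda B\end{pmatrix}\succ0 .$$ For data $(A,B,Q,S,R)$, a solution of the DARE is a symmetric $P$ with $R+B^\top PB$ invertible and $$P=Q+A^\top PA-(S^\top+A^\top PB)K,\qquad K=(R+B^\top PB)^{-1}(S+B^\top PA);$$ it is called stabilizing if all eigenvalues of $A-BK$ have modulus $<1$. If $A$ is invertible, the RDARE of these data is the DARE for the data $\bar A=A^{-1}$, $\bar B=A^{-1}B$, $\bar Q=-\bar A^\top Q\bar A$, $\bar S=S\bar A-\bar B^\top Q\bar A$, $\bar R=-R+S\bar B+\bar B^\top S^\top-\bar B^\top Q\bar B$. In general, choose any $\hat K$ such that $A-B\hat K$ is invertible (such $\hat K$ exist; $\hat K=0$ if $A$ is invertible) and use the RDARE of the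 data $(A-B\hat K,\;B,\;Q-S^\top\hat K-\hat K^\top S+\hat K^\top R\hat K,\;S-R\hat K,\;R)$. Theorem. The DARE of $(A,B,Q,S,R)$ has a unique stabilizing solution $P_{\mathrm s}$, with feedback matrix $K_{\mathrm s}$, and, for every such $\hat K$, the RDARE has a unique stabilizing solution $\bar P_{\mathrm s}$. Let $E\succ0$ and $P^{\mathrm f}=\bar P_{\mathrm s}+E$. Then for every $x_0\in\mathbb R^n$ the infinite-horizon problem $$\min_{u_0,u_1,\dots}\ \lim_{N\to\infty}\ \sum_{k=0}^{N-1}\begin{pmatrix}x_k\\u_k\end{pmatrix}^{\!\top}\! H\begin{pmatrix}x_k\\u_k\end{pmatrix}+x_N^\top P^{\mathrm f}x_N\qquad\text{s.t. } x_{k+1}=Ax_k+Bu_k$$ (control sequences whose cost has no limit being compared through the lower limit) has exactly one optimal control sequence, namely the one generated by the feedback $u_k=-K_{\mathrm s}x_k$, and its optimal value is $x_0^\top P_{\mathrm s}x_0$. In particular, the origin is a (globally) asymptotically stable equilibrium of the optimally controlled system $x_{k+1}=(A-BK_{\mathrm s})x_k$. No existence of an antistabilizing solution of the DARE is assumed.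 -/

import Mathlib

open Filter Topology
open scoped Matrix

/-- Data of a discrete-time linear-quadratic optimal control problem with state space `ℝⁿ` and
input space `ℝᵐ`: dynamics `x⁺ = A x + B u` and stage cost with matrix `[Q Sᵀ; S R]`. -/
structure LQProblem (n m : ℕ) where
  /-- state matrix -/
  A : Matrix (Fin n) (Fin n) ℝ
  /-- input matrix -/
  B : Matrix (Fin n) (Fin m) ℝ
  /-- state weight -/
  Q : Matrix (Fin n) (Fin n) ℝ
  /-- cross weight -/
  S : Matrix (Fin m) (Fin n) ℝ
  /-- input weight -/
  R : Matrix (Fin m) (Fin m) ℝ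

/-- All complex eigenvalues lie strictly inside the unit circle. -/
def IsSchurStable {n : ℕ} (M : Matrix (Fin n) (Fin n) ℝ) : Prop :=
  ∀ μ ∈ spectrum ℂ (M.map (algebraMap ℝ ℂ)), ‖μ‖ < 1

/-- The origin is an equilibrium of `x⁺ = f x` that is Lyapunov stable and globally attractive. -/
def IsGloballyAsymptoticallyStable {n : ℕ} (f : (Fin n → ℝ) → (Fin n → ℝ)) : Prop :=
  f 0 = 0 ∧
  (∀ ε > 0, ∃ δ > 0, ∀ x, ‖x‖ < δ → ∀ k : ℕ, ‖f^[k] x‖ < ε) ∧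
  (∀ x, Tendsto (fun k : ℕ => f^[k] x) atTop (𝓝 0))

namespace LQProblem

noncomputable section

variable {n m : ℕ}

/-- The stage cost matrix `H`. -/
def H (p : LQProblem n m) : Matrix (Fin n ⊕ Fin m) (Fin n ⊕ Fin m) ℝ :=
  Matrix.fromBlocks p.Q p.Sᵀ p.S p.R

/-- The rotated stage cost matrix `H_Λ`, for the storage function `x ↦ xᵀ Λ x`. -/
def rotatedH (p : LQProblem n m) (L : Matrix (Fin n) (Fin n) ℝ) :
    Matrix (Fin n ⊕ Fin m) (Fin n ⊕ Fin m) ℝ :=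
  Matrix.fromBlocks
    (p.Q + L - p.Aᵀ * L * p.A) (p.Sᵀ - p.Aᵀ * L * p.B)
    (p.S - p.Bᵀ * L * p.A) (p.R - p.Bᵀ * L * p.B)

/-- Quadratic strict `(x,u)`-pre-dissipativity. The matrix `Λ` need not be semidefinite.
Note that `PosDef` includes symmetry, so that `Q` and `R` are symmetric as well. -/
def StrictlyPreDissipative (p : LQProblem n m) : Prop :=
  ∃ L : Matrix (Fin n) (Fin n) ℝ, L.IsSymm ∧ (p.rotatedH L).PosDef

/-- Controllability of `(A,B)`: the Kalman matrix `[B, A B, …, Aⁿ⁻¹ B]` has rank `n`. -/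
def Controllable (p : LQProblem n m) : Prop :=
  (Matrix.of fun (i : Fin n) (kj : Fin n × Fin m) =>
    (p.A ^ (kj.1 : ℕ) * p.B) i kj.2).rank = n

/-- The feedback matrix `K = (R + Bᵀ P B)⁻¹ (S + Bᵀ P A)` associated with `P`. -/
def gain (p : LQProblem n m) (P : Matrix (Fin n) (Fin n) ℝ) : Matrix (Fin m) (Fin n) ℝ :=
  (p.R + p.Bᵀ * P * p.B)⁻¹ * (p.S + p.Bᵀ * P * p.A)

/-- `P` is a symmetric solution of the discrete-time algebraic Riccati equation (DARE); the inverse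
occurring in the equation is required to exist. -/
def IsDARESolution (p : LQProblem n m) (P : Matrix (Fin n) (Fin n) ℝ) : Prop :=
  P.IsSymm ∧ IsUnit (p.R + p.Bᵀ * P * p.B).det ∧
  P = p.Q + p.Aᵀ * P * p.A - (p.Sᵀ + p.Aᵀ * P * p.B) * p.gain P

/-- `P` is a stabilizing solution of the DARE. -/
def IsStabilizingSolution (p : LQProblem n m) (P : Matrix (Fin n) (Fin n) ℝ) : Prop :=
  p.IsDARESolution P ∧ IsSchurStable (p.A - p.B * p.gain P)

/-- The problem in the new input `ū`, where `u = ū - K̂ x`. -/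
def preFeedback (p : LQProblem n m) (Khat : Matrix (Fin m) (Fin n) ℝ) : LQProblem n m where
  A := p.A - p.B * Khat
  B := p.B
  Q := p.Q - p.Sᵀ * Khat - Khatᵀ * p.S + Khatᵀ * p.R * Khat
  S := p.S - p.R * Khat
  R := p.R

/-- The data `Ā, B̄, Q̄, S̄, R̄` of the reverse DARE (RDARE), meaningful if `A` is invertible. The RDARE
is the DARE formed with these data. -/
def reverse (p : LQProblem n m) : LQProblem n m where
  A := p.A⁻¹
  B := p.A⁻¹ * p.B
  Q := -((p.A⁻¹)ᵀ * p.Q * p.A⁻¹)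
  S := p.S * p.A⁻¹ - (p.A⁻¹ * p.B)ᵀ * p.Q * p.A⁻¹
  R := -p.R + p.S * (p.A⁻¹ * p.B) + (p.A⁻¹ * p.B)ᵀ * p.Sᵀ
    - (p.A⁻¹ * p.B)ᵀ * p.Q * (p.A⁻¹ * p.B)

/-- The stage cost `ℓ(x,u) = [x; u]ᵀ H [x; u]`. -/
def stageCost (p : LQProblem n m) (x : Fin n → ℝ) (u : Fin m → ℝ) : ℝ :=
  Sum.elim x u ⬝ᵥ (p.H *ᵥ Sum.elim x u)

/-- The state trajectory generated by a control sequence. -/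
def state (p : LQProblem n m) (x₀ : Fin n → ℝ) (u : ℕ → Fin m → ℝ) : ℕ → Fin n → ℝ
  | 0 => x₀
  | k + 1 => p.A *ᵥ p.state x₀ u k + p.B *ᵥ u k

/-- The horizon-`N` cost `∑_{k<N} ℓ(x_k,u_k) + x_Nᵀ Pf x_N`. -/
def cost (p : LQProblem n m) (Pf : Matrix (Fin n) (Fin n) ℝ) (x₀ : Fin n → ℝ)
    (u : ℕ → Fin m → ℝ) (N : ℕ) : ℝ :=
  ∑ k ∈ Finset.range N, p.stageCost (p.state x₀ u k) (u k)
    + p.state x₀ u N ⬝ᵥ (Pf *ᵥ p.state x₀ u N)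

/-- The closed-loop map `x ↦ A x + B (-K x)`. -/
def closedLoop (p : LQProblem n m) (K : Matrix (Fin m) (Fin n) ℝ) (x : Fin n → ℝ) : Fin n → ℝ :=
  p.A *ᵥ x + p.B *ᵥ (-(K *ᵥ x))

/-- The control sequence generated from `x₀` by the feedback law `u = -K x`. -/
def feedbackControl (p : LQProblem n m) (K : Matrix (Fin m) (Fin n) ℝ) (x₀ : Fin n → ℝ) :
    ℕ → Fin m → ℝ :=
  fun k => -(K *ᵥ ((p.closedLoop K)^[k] x₀))

/-- `u` solves the infinite-horizon problem `min_u lim_{N → ∞} cost N`: its cost has a limit `v`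
(in the extended reals), and no control sequence does better; control sequences whose cost has no
limit are compared through the lower limit. -/
def IsOptimalControl (p : LQProblem n m) (Pf : Matrix (Fin n) (Fin n) ℝ) (x₀ : Fin n → ℝ)
    (u : ℕ → Fin m → ℝ) : Prop :=
  ∃ v : EReal, Tendsto (fun N => (p.cost Pf x₀ u N : EReal)) atTop (𝓝 v) ∧
    ∀ u' : ℕ → Fin m → ℝ, v ≤ liminf (fun N => (p.cost Pf x₀ u' N : EReal)) atTop

end

end LQProblem

/-!
Adding `xᵀ L x - (x⁺)ᵀ L x⁺` to the stage cost, where `L` is the storage matrix of the strict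
dissipation inequality, makes the stage cost positive definite and changes the cost only by boundary
terms. All positivity statements below come from this rotation; it would replace a solution `P` of
the DARE by `P + L` without changing the feedback matrix.

*Riccati equations.* Completing the square (`stageCost_add_quadVal`) shows that a solution `P` of
the DARE turns the stage cost into `V(x) - V(x⁺)`, with `V(x) = xᵀ P x`, plus the quadratic form of
`R + Bᵀ P B` at `u + K x`. If `P` is stabilizing, then `P + L` is positive semidefinite, hence
`R + Bᵀ P B` is positive definite, and comparison of two feedback laws gives uniqueness. Existence
comes from value iteration started at `-L`: it increases, it is bounded because every state can be
steered to the origin, and Lyapunov's criterion shows that its limit is stabilizing. The RDARE is,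
up to the sign of the stage cost, the DARE of the system run backwards in time, which dissipates
with storage matrix `-L` and in which reachable states are steered to the origin. So the same
results apply to it.

*Optimality.* The stabilizing solution `P̄` of the RDARE writes the cost with terminal weight
`P̄ + E` as a constant, plus a sum of nonnegative terms, plus the form of `E` at the terminal state.
If the cost is bounded along a subsequence of horizons, then the sum converges and the terminal
states are bounded along that subsequence. Since the closed loop of the backward system is Schur
stable, solving for the state backwards in time shows that the whole trajectory tends to zero
(`tendsto_state_zero`). For such a trajectory the terminal weight is irrelevant, and the completion
of the square with the stabilizing solution `Pₛ` of the DARE gives the cost `x₀ᵀ Pₛ x₀` plus a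
penalty that vanishes exactly for the feedback law.
-/

/-! ### Quadratic forms of matrices -/

/-- The value `xᵀ P x` of the quadratic form of `P` at `x`. -/
def quadVal {n : ℕ} (P : Matrix (Fin n) (Fin n) ℝ) (x : Fin n → ℝ) : ℝ :=
  x ⬝ᵥ (P *ᵥ x)

section quadVal

variable {n m : ℕ}

@[simp] theorem quadVal_zero (P : Matrix (Fin n) (Fin n) ℝ) : quadVal P 0 = 0 := by
  simp [quadVal]

theorem quadVal_add_left (P P' : Matrix (Fin n) (Fin n) ℝ) (x : Fin n → ℝ) :
    quadVal (P + P') x = quadVal P x + quadVal P' x := by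
  simp [quadVal, Matrix.add_mulVec]

theorem quadVal_sub_left (P P' : Matrix (Fin n) (Fin n) ℝ) (x : Fin n → ℝ) :
    quadVal (P - P') x = quadVal P x - quadVal P' x := by
  simp [quadVal, Matrix.sub_mulVec]

theorem quadVal_neg_left (P : Matrix (Fin n) (Fin n) ℝ) (x : Fin n → ℝ) :
    quadVal (-P) x = -quadVal P x := by
  simp [quadVal, Matrix.neg_mulVec]

theorem quadVal_smul_right (P : Matrix (Fin n) (Fin n) ℝ) (c : ℝ) (x : Fin n → ℝ) :
    quadVal P (c • x) = c ^ 2 * quadVal P x := by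
  simp only [quadVal, Matrix.mulVec_smul, dotProduct_smul, smul_dotProduct, smul_eq_mul]
  ring

theorem quadVal_neg_right (P : Matrix (Fin n) (Fin n) ℝ) (x : Fin n → ℝ) :
    quadVal P (-x) = quadVal P x := by
  simp [quadVal, Matrix.mulVec_neg]

theorem continuous_quadVal (P : Matrix (Fin n) (Fin n) ℝ) : Continuous (quadVal P) := by
  unfold quadVal
  fun_prop

theorem dotProduct_transpose_mulVec (C : Matrix (Fin m) (Fin n) ℝ) (x : Fin n → ℝ)
    (y : Fin m → ℝ) : x ⬝ᵥ (Cᵀ *ᵥ y) = (C *ᵥ x) ⬝ᵥ y := by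
  rw [Matrix.dotProduct_mulVec, Matrix.vecMul_transpose]

theorem quadVal_congruence (P : Matrix (Fin n) (Fin n) ℝ) (C : Matrix (Fin n) (Fin m) ℝ)
    (x : Fin m → ℝ) : quadVal (Cᵀ * P * C) x = quadVal P (C *ᵥ x) := by
  rw [quadVal, quadVal, Matrix.mul_assoc, ← Matrix.mulVec_mulVec, dotProduct_transpose_mulVec,
    Matrix.mulVec_mulVec]

theorem Matrix.IsSymm.dotProduct_mulVec_comm {P : Matrix (Fin n) (Fin n) ℝ} (hP : P.IsSymm)
    (x y : Fin n → ℝ) : x ⬝ᵥ (P *ᵥ y) = y ⬝ᵥ (P *ᵥ x) := by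
  conv_lhs => rw [← hP.eq]
  rw [dotProduct_transpose_mulVec, dotProduct_comm]

theorem quadVal_add_right {P : Matrix (Fin n) (Fin n) ℝ} (hP : P.IsSymm) (x y : Fin n → ℝ) :
    quadVal P (x + y) = quadVal P x + 2 * (x ⬝ᵥ (P *ᵥ y)) + quadVal P y := by
  simp only [quadVal, Matrix.mulVec_add, add_dotProduct, dotProduct_add]
  rw [hP.dotProduct_mulVec_comm y x]
  ring

/-- Polarization: the entries of a symmetric matrix are values of its quadratic form. -/
theorem Matrix.IsSymm.apply_eq_quadVal {P : Matrix (Fin n) (Fin n) ℝ} (hP : P.IsSymm)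
    (i j : Fin n) :
    P i j = (quadVal P (Pi.single i 1 + Pi.single j 1) - quadVal P (Pi.single i 1)
      - quadVal P (Pi.single j 1)) / 2 := by
  rw [quadVal_add_right hP]
  simp
  ring

theorem Matrix.IsSymm.ext_quadVal {P P' : Matrix (Fin n) (Fin n) ℝ} (hP : P.IsSymm)
    (hP' : P'.IsSymm) (h : ∀ x, quadVal P x = quadVal P' x) : P = P' := by
  ext i j
  rw [hP.apply_eq_quadVal, hP'.apply_eq_quadVal]
  simp only [h]

theorem quadVal_nonneg_of_pos {M : Matrix (Fin n) (Fin n) ℝ}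
    (hM : ∀ x, x ≠ 0 → 0 < quadVal M x) (x : Fin n → ℝ) : 0 ≤ quadVal M x := by
  obtain rfl | hx := eq_or_ne x 0
  · simp
  · exact (hM x hx).le

theorem isUnit_det_of_quadVal_ne_zero {M : Matrix (Fin n) (Fin n) ℝ}
    (hM : ∀ x, x ≠ 0 → quadVal M x ≠ 0) : IsUnit M.det := by
  rw [isUnit_iff_ne_zero]
  intro h
  obtain ⟨v, hv, hv0⟩ := Matrix.exists_mulVec_eq_zero_iff.mpr h
  exact hM v hv (by simp [quadVal, hv0])

/-- A positive definite form is bounded below by a multiple of the squared norm, as the unit sphere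
is compact. -/
theorem exists_pos_mul_sq_norm_le_quadVal {M : Matrix (Fin n) (Fin n) ℝ}
    (hM : ∀ x, x ≠ 0 → 0 < quadVal M x) : ∃ c > 0, ∀ x, c * ‖x‖ ^ 2 ≤ quadVal M x := by
  obtain h | h := (Metric.sphere (0 : Fin n → ℝ) 1).eq_empty_or_nonempty
  · refine ⟨1, one_pos, fun x => ?_⟩
    have hx : x = 0 := by
      by_contra hx
      have : ‖x‖⁻¹ • x ∈ Metric.sphere (0 : Fin n → ℝ) 1 := by
        simp [norm_smul, norm_ne_zero_iff.mpr hx]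
      simp [h] at this
    simp [hx]
  · obtain ⟨y, hy, hmin⟩ := (isCompact_sphere (0 : Fin n → ℝ) 1).exists_isMinOn h
      (continuous_quadVal M).continuousOn
    have hy0 : y ≠ 0 := by
      rintro rfl
      simp at hy
    refine ⟨quadVal M y, hM y hy0, fun x => ?_⟩
    by_cases hx : x = 0
    · simp [hx]
    have hxn : ‖x‖ ≠ 0 := norm_ne_zero_iff.mpr hx
    have h1 : quadVal M y ≤ quadVal M (‖x‖⁻¹ • x) := hmin (by simp [norm_smul, hxn])
    rw [quadVal_smul_right] at h1
    calc quadVal M y * ‖x‖ ^ 2 ≤ (‖x‖⁻¹ ^ 2 * quadVal M x) * ‖x‖ ^ 2 := by gcongr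
      _ = quadVal M x := by field_simp

theorem tendsto_zero_of_tendsto_quadVal {ι : Type*} {l : Filter ι} {M : Matrix (Fin n) (Fin n) ℝ}
    (hM : ∀ x, x ≠ 0 → 0 < quadVal M x) {w : ι → Fin n → ℝ}
    (hw : Tendsto (fun k => quadVal M (w k)) l (𝓝 0)) : Tendsto w l (𝓝 0) := by
  obtain ⟨c, hc, hcM⟩ := exists_pos_mul_sq_norm_le_quadVal hM
  have h1 : Tendsto (fun k => ‖w k‖ ^ 2) l (𝓝 0) := by
    refine squeeze_zero (fun k => by positivity) (fun k => ?_)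
      (by simpa using hw.const_mul c⁻¹)
    rw [inv_mul_eq_div, le_div_iff₀ hc, mul_comm]
    exact hcM _
  rw [tendsto_zero_iff_norm_tendsto_zero]
  simpa [Real.sqrt_sq] using h1.sqrt

end quadVal

/-! ### Schur stable matrices -/

section Schur

variable {n : ℕ}

attribute [local instance] Matrix.linftyOpNormedAddCommGroup Matrix.linftyOpNormedRing
  Matrix.linftyOpNormedAlgebra

/-- Gelfand's formula turns the bound on the spectrum into a summable bound on the powers. -/
theorem IsSchurStable.exists_summable_bound {F : Matrix (Fin n) (Fin n) ℝ} (hF : IsSchurStable F) :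
    ∃ a : ℕ → ℝ, Summable a ∧ (∀ k, 0 ≤ a k) ∧ ∀ k x, ‖(F ^ k) *ᵥ x‖ ≤ a k * ‖x‖ := by
  refine ⟨fun k => ‖F ^ k‖, ?_, fun k => norm_nonneg _,
    fun k x => Matrix.linfty_opNorm_mulVec _ _⟩
  set G : Matrix (Fin n) (Fin n) ℂ := F.map (algebraMap ℝ ℂ) with hG
  have hnorm : ∀ k, ‖F ^ k‖ = ‖G ^ k‖ := by
    intro k
    have h1 : G ^ k = (F ^ k).map (algebraMap ℝ ℂ) := by
      rw [hG]
      exact ((algebraMap ℝ ℂ).mapMatrix.map_pow F k).symm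
    rw [h1, Matrix.linfty_opNorm_def, Matrix.linfty_opNorm_def]
    simp
  have hrad : spectralRadius ℂ G < (1 : NNReal) := by
    obtain h | h := (spectrum ℂ G).eq_empty_or_nonempty
    · simp [spectralRadius, h]
    · refine spectrum.spectralRadius_lt_of_forall_lt_of_nonempty h fun k hk => ?_
      exact_mod_cast hF k hk
  obtain ⟨r, hr, hr1⟩ := ENNReal.lt_iff_exists_nnreal_btwn.mp hrad
  have hr1' : r < 1 := by exact_mod_cast hr1
  have hev := (spectrum.pow_nnnorm_pow_one_div_tendsto_nhds_spectralRadius G).eventually_lt_const hr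
  refine Summable.of_norm_bounded_eventually_nat (g := fun k => (r : ℝ) ^ k)
    (summable_geometric_of_lt_one r.2 (by exact_mod_cast hr1')) ?_
  filter_upwards [hev, eventually_gt_atTop 0] with k hk hk0
  rw [norm_norm, hnorm]
  have h2 : (‖G ^ k‖₊ : ENNReal) ≤ (r : ENNReal) ^ k := by
    have := ENNReal.rpow_le_rpow hk.le (Nat.cast_nonneg (α := ℝ) k)
    rw [← ENNReal.rpow_mul, one_div, inv_mul_cancel₀ (by exact_mod_cast hk0.ne'),
      ENNReal.rpow_one, ENNReal.rpow_natCast] at this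
    exact this
  have h3 : ‖G ^ k‖₊ ≤ r ^ k := by exact_mod_cast h2
  exact_mod_cast h3

theorem IsSchurStable.tendsto_pow_mulVec {F : Matrix (Fin n) (Fin n) ℝ} (hF : IsSchurStable F)
    (x : Fin n → ℝ) : Tendsto (fun k => (F ^ k) *ᵥ x) atTop (𝓝 0) := by
  obtain ⟨a, ha, -, hb⟩ := hF.exists_summable_bound
  rw [tendsto_zero_iff_norm_tendsto_zero]
  refine squeeze_zero (fun k => norm_nonneg _) (fun k => hb k x) ?_
  simpa using ha.tendsto_atTop_zero.mul_const ‖x‖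

/-- A quadratic form that does not increase along a Schur stable system is nonnegative. -/
theorem IsSchurStable.quadVal_nonneg {F D : Matrix (Fin n) (Fin n) ℝ} (hF : IsSchurStable F)
    (hD : ∀ x, quadVal D (F *ᵥ x) ≤ quadVal D x) (x : Fin n → ℝ) : 0 ≤ quadVal D x := by
  have h1 : ∀ k : ℕ, quadVal D ((F ^ k) *ᵥ x) ≤ quadVal D x := by
    intro k
    induction k with
    | zero => simp
    | succ k ih =>
      rw [pow_succ', ← Matrix.mulVec_mulVec]
      exact (hD _).trans ih
  have h2 := ((continuous_quadVal D).tendsto 0).comp (hF.tendsto_pow_mulVec x)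
  rw [quadVal_zero] at h2
  exact le_of_tendsto' h2 h1

/-- Lyapunov's criterion. -/
theorem isSchurStable_of_quadVal_lt {F X : Matrix (Fin n) (Fin n) ℝ} (hX : X.IsSymm)
    (hX0 : ∀ x, 0 ≤ quadVal X x) (hlt : ∀ x, x ≠ 0 → quadVal X (F *ᵥ x) < quadVal X x) :
    IsSchurStable F := by
  intro μ hμ
  rw [spectrum.mem_iff, Matrix.isUnit_iff_isUnit_det, isUnit_iff_ne_zero, not_not,
    ← Matrix.exists_mulVec_eq_zero_iff] at hμ
  obtain ⟨v, hv, hv0⟩ := hμ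
  rw [Matrix.sub_mulVec, sub_eq_zero, Algebra.algebraMap_eq_smul_one, Matrix.smul_mulVec,
    Matrix.one_mulVec] at hv0
  -- The real and imaginary parts of an eigenvector span an invariant plane on which `F` acts as a
  -- rotation followed by scaling with `‖μ‖`.
  set a : Fin n → ℝ := fun i => (v i).re with ha
  set b : Fin n → ℝ := fun i => (v i).im with hb
  have hFa : F *ᵥ a = μ.re • a + (-μ.im) • b := by
    ext i
    have := congrArg Complex.re (congrFun hv0 i)
    simp only [Pi.smul_apply, smul_eq_mul, Complex.mul_re, Matrix.mulVec, dotProduct,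
      Matrix.map_apply, Complex.re_sum] at this
    simp only [Matrix.mulVec, dotProduct, ha, hb, Pi.add_apply, Pi.smul_apply, smul_eq_mul]
    simp at this
    linarith
  have hFb : F *ᵥ b = μ.im • a + μ.re • b := by
    ext i
    have := congrArg Complex.im (congrFun hv0 i)
    simp only [Pi.smul_apply, smul_eq_mul, Complex.mul_im, Matrix.mulVec, dotProduct,
      Matrix.map_apply, Complex.im_sum] at this
    simp only [Matrix.mulVec, dotProduct, ha, hb, Pi.add_apply, Pi.smul_apply, smul_eq_mul]
    simp at this
    linarith
  have hsum : quadVal X (F *ᵥ a) + quadVal X (F *ᵥ b)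
      = ‖μ‖ ^ 2 * (quadVal X a + quadVal X b) := by
    rw [hFa, hFb, quadVal_add_right hX, quadVal_add_right hX, Complex.sq_norm, Complex.normSq_apply]
    simp only [quadVal_smul_right, Matrix.mulVec_smul, dotProduct_smul, smul_dotProduct,
      smul_eq_mul]
    ring
  have hle : ∀ x, quadVal X (F *ᵥ x) ≤ quadVal X x := by
    intro x
    by_cases hx : x = 0
    · simp [hx]
    · exact (hlt x hx).le
  have hstrict : quadVal X (F *ᵥ a) + quadVal X (F *ᵥ b) < quadVal X a + quadVal X b := by
    by_cases ha0 : a = 0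
    · have hb0 : b ≠ 0 := by
        intro hb0
        apply hv
        ext i
        exact Complex.ext (congrFun ha0 i) (congrFun hb0 i)
      exact add_lt_add_of_le_of_lt (hle a) (hlt b hb0)
    · exact add_lt_add_of_lt_of_le (hlt a ha0) (hle b)
  by_contra h
  have h1 : 1 ≤ ‖μ‖ ^ 2 := one_le_pow₀ (not_lt.mp h)
  linarith [le_mul_of_one_le_left (add_nonneg (hX0 a) (hX0 b)) h1]

/-- If the backward recursion `x k = F x (k+1) + e k` is driven by a vanishing input and `F` is
Schur stable, then `x` tends to zero as soon as a subsequence of it is bounded: the terminal value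
`x N` enters `x k` only through `F ^ (N - k)`. -/
theorem IsSchurStable.tendsto_zero_of_backward {F : Matrix (Fin n) (Fin n) ℝ}
    (hF : IsSchurStable F) {x e : ℕ → Fin n → ℝ} (hx : ∀ k, x k = F *ᵥ x (k + 1) + e k)
    (he : Tendsto e atTop (𝓝 0)) {C : ℝ} (hC : ∃ᶠ N in atTop, ‖x N‖ ≤ C) :
    Tendsto x atTop (𝓝 0) := by
  obtain ⟨a, ha, ha0, hb⟩ := hF.exists_summable_bound
  have hsol : ∀ j k, x k = (F ^ j) *ᵥ x (k + j)
      + ∑ i ∈ Finset.range j, (F ^ i) *ᵥ e (k + i) := by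
    intro j k
    induction j with
    | zero => simp
    | succ j ih =>
      rw [ih, Finset.sum_range_succ, hx (k + j), Matrix.mulVec_add, Matrix.mulVec_mulVec,
        ← pow_succ, ← add_assoc k j 1]
      abel
  have hS : 0 ≤ ∑' i, a i := tsum_nonneg ha0
  rw [Metric.tendsto_atTop]
  intro ε hε
  obtain ⟨K, hK⟩ := Metric.tendsto_atTop.mp he (ε / (2 * (∑' i, a i + 1))) (by positivity)
  refine ⟨K, fun k hk => ?_⟩
  rw [dist_zero_right]
  have hlim : Tendsto (fun N => a (N - k) * C) atTop (𝓝 0) := by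
    simpa using (ha.tendsto_atTop_zero.comp (tendsto_sub_atTop_nat k)).mul_const C
  obtain ⟨N, hN, hN', hkN⟩ := (hC.and_eventually
    ((hlim.eventually_lt_const (half_pos hε)).and (eventually_ge_atTop k))).exists
  obtain ⟨j, rfl⟩ := Nat.exists_eq_add_of_le hkN
  rw [Nat.add_sub_cancel_left] at hN'
  have h1 : ‖(F ^ j) *ᵥ x (k + j)‖ < ε / 2 :=
    ((hb _ _).trans (mul_le_mul_of_nonneg_left hN (ha0 _))).trans_lt hN'
  have h2 : ‖∑ i ∈ Finset.range j, (F ^ i) *ᵥ e (k + i)‖ ≤ ε / 2 := by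
    calc ‖∑ i ∈ Finset.range j, (F ^ i) *ᵥ e (k + i)‖
        ≤ ∑ i ∈ Finset.range j, a i * (ε / (2 * (∑' i, a i + 1))) := by
          refine norm_sum_le_of_le _ fun i _ => (hb _ _).trans ?_
          have := hK (k + i) (by omega)
          rw [dist_zero_right] at this
          exact mul_le_mul_of_nonneg_left this.le (ha0 i)
      _ ≤ (∑' i, a i) * (ε / (2 * (∑' i, a i + 1))) := by
          rw [← Finset.sum_mul]
          gcongr
          exact ha.sum_le_tsum _ fun i _ => ha0 i
      _ ≤ (∑' i, a i + 1) * (ε / (2 * (∑' i, a i + 1))) := by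
          gcongr
          linarith
      _ = ε / 2 := by field_simp
  rw [hsol j k]
  exact (norm_add_le _ _).trans_lt (by linarith)

end Schur

namespace LQProblem

variable {n m : ℕ}

/-! ### Stage cost and completion of the square -/

theorem stageCost_eq (p : LQProblem n m) (x : Fin n → ℝ) (u : Fin m → ℝ) :
    p.stageCost x u = quadVal p.Q x + 2 * (u ⬝ᵥ (p.S *ᵥ x)) + quadVal p.R u := by
  have h : x ⬝ᵥ (p.Sᵀ *ᵥ u) = u ⬝ᵥ (p.S *ᵥ x) := by
    rw [dotProduct_transpose_mulVec, dotProduct_comm]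
  simp only [stageCost, H, Matrix.fromBlocks_mulVec, Sum.elim_comp_inl, Sum.elim_comp_inr,
    sumElim_dotProduct_sumElim, dotProduct_add, quadVal, h]
  ring

/-- `S + Bᵀ P A = (R + Bᵀ P B) K`. -/
theorem mul_gain (p : LQProblem n m) {P : Matrix (Fin n) (Fin n) ℝ}
    (hM : IsUnit (p.R + p.Bᵀ * P * p.B).det) :
    (p.R + p.Bᵀ * P * p.B) * p.gain P = p.S + p.Bᵀ * P * p.A :=
  Matrix.mul_nonsing_inv_cancel_left _ _ hM

/-- The right-hand side `Q + Aᵀ P A - (Sᵀ + Aᵀ P B) K` of the DARE. -/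
noncomputable def riccati (p : LQProblem n m) (P : Matrix (Fin n) (Fin n) ℝ) :
    Matrix (Fin n) (Fin n) ℝ :=
  p.Q + p.Aᵀ * P * p.A - (p.Sᵀ + p.Aᵀ * P * p.B) * p.gain P

theorem isSymm_inputHessian {p : LQProblem n m} (hR : p.R.IsSymm)
    {P : Matrix (Fin n) (Fin n) ℝ} (hP : P.IsSymm) : (p.R + p.Bᵀ * P * p.B).IsSymm := by
  simp only [Matrix.IsSymm, Matrix.transpose_add, Matrix.transpose_mul, Matrix.transpose_transpose,
    hR.eq, hP.eq, Matrix.mul_assoc]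

theorem riccati_eq {p : LQProblem n m} {P : Matrix (Fin n) (Fin n) ℝ} (hR : p.R.IsSymm)
    (hP : P.IsSymm) (hM : IsUnit (p.R + p.Bᵀ * P * p.B).det) :
    p.riccati P = p.Q + p.Aᵀ * P * p.A
      - (p.gain P)ᵀ * ((p.R + p.Bᵀ * P * p.B) * p.gain P) := by
  have h : p.Sᵀ + p.Aᵀ * P * p.B = (p.gain P)ᵀ * (p.R + p.Bᵀ * P * p.B) := by
    have := congrArg Matrix.transpose (p.mul_gain hM)
    rw [Matrix.transpose_mul, (isSymm_inputHessian hR hP).eq] at this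
    rw [this]
    simp [Matrix.transpose_mul, hP.eq, Matrix.mul_assoc]
  rw [riccati, h, Matrix.mul_assoc (p.gain P)ᵀ]

theorem isSymm_riccati {p : LQProblem n m} {P : Matrix (Fin n) (Fin n) ℝ} (hQ : p.Q.IsSymm)
    (hR : p.R.IsSymm) (hP : P.IsSymm) (hM : IsUnit (p.R + p.Bᵀ * P * p.B).det) :
    (p.riccati P).IsSymm := by
  have hMs := (isSymm_inputHessian hR hP).eq
  rw [riccati_eq hR hP hM, Matrix.IsSymm]
  rw [Matrix.transpose_sub, Matrix.transpose_add, Matrix.transpose_mul (p.gain P)ᵀ,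
    Matrix.transpose_mul _ (p.gain P), hMs]
  simp only [Matrix.transpose_mul, Matrix.transpose_transpose, hQ.eq, hP.eq, Matrix.mul_assoc]

theorem stageCost_add_quadVal {p : LQProblem n m} {P : Matrix (Fin n) (Fin n) ℝ}
    (hR : p.R.IsSymm) (hP : P.IsSymm) (hM : IsUnit (p.R + p.Bᵀ * P * p.B).det)
    (x : Fin n → ℝ) (u : Fin m → ℝ) :
    p.stageCost x u + quadVal P (p.A *ᵥ x + p.B *ᵥ u)
      = quadVal (p.riccati P) x
        + quadVal (p.R + p.Bᵀ * P * p.B) (u + p.gain P *ᵥ x) := by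
  have hMs := isSymm_inputHessian hR hP
  rw [quadVal_add_right hMs, riccati_eq hR hP hM, stageCost_eq, quadVal_add_right hP]
  have h1 : quadVal ((p.gain P)ᵀ * ((p.R + p.Bᵀ * P * p.B) * p.gain P)) x
      = quadVal (p.R + p.Bᵀ * P * p.B) (p.gain P *ᵥ x) := by
    rw [quadVal, quadVal, ← Matrix.mulVec_mulVec, dotProduct_transpose_mulVec,
      Matrix.mulVec_mulVec]
  rw [quadVal_sub_left, h1, quadVal_add_left, quadVal_add_left _ _ u]
  have h4 : u ⬝ᵥ ((p.S + p.Bᵀ * P * p.A) *ᵥ x)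
      = u ⬝ᵥ (p.S *ᵥ x) + (p.A *ᵥ x) ⬝ᵥ (P *ᵥ (p.B *ᵥ u)) := by
    rw [Matrix.add_mulVec, dotProduct_add, Matrix.mul_assoc, ← Matrix.mulVec_mulVec,
      dotProduct_transpose_mulVec, ← Matrix.mulVec_mulVec, hP.dotProduct_mulVec_comm (p.B *ᵥ u)]
  rw [← p.mul_gain hM, ← Matrix.mulVec_mulVec] at h4
  rw [quadVal_congruence, quadVal_congruence, h4]
  ring

theorem IsDARESolution.riccati_eq {p : LQProblem n m} {P : Matrix (Fin n) (Fin n) ℝ}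
    (h : p.IsDARESolution P) : p.riccati P = P :=
  h.2.2.symm

/-- Along trajectories, a solution of the DARE turns the stage cost into a telescoping term plus
the quadratic form of `R + Bᵀ P B` at the deviation from the feedback law. -/
theorem IsDARESolution.stageCost_add_quadVal {p : LQProblem n m} {P : Matrix (Fin n) (Fin n) ℝ}
    (h : p.IsDARESolution P) (hR : p.R.IsSymm) (x : Fin n → ℝ) (u : Fin m → ℝ) :
    p.stageCost x u + quadVal P (p.A *ᵥ x + p.B *ᵥ u)
      = quadVal P x + quadVal (p.R + p.Bᵀ * P * p.B) (u + p.gain P *ᵥ x) := by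
  rw [LQProblem.stageCost_add_quadVal hR h.1 h.2.1, h.riccati_eq]

/-! ### Strict dissipation inequality -/

/-- The dissipation inequality with storage function `x ↦ xᵀ L x`, in terms of the stage cost and
one step of the dynamics; the form in which pre-dissipativity is transported between problems. -/
structure DissipatesWith (p : LQProblem n m) (L : Matrix (Fin n) (Fin n) ℝ) : Prop where
  isSymm_Q : p.Q.IsSymm
  isSymm_R : p.R.IsSymm
  isSymm : L.IsSymm
  pos : ∀ x u, (x ≠ 0 ∨ u ≠ 0) →
    0 < p.stageCost x u + quadVal L x - quadVal L (p.A *ᵥ x + p.B *ᵥ u)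

theorem StrictlyPreDissipative.exists_dissipatesWith {p : LQProblem n m}
    (h : p.StrictlyPreDissipative) : ∃ L, p.DissipatesWith L := by
  obtain ⟨L, hL, hpos⟩ := h
  have hsymm := hpos.isHermitian
  rw [rotatedH, Matrix.isHermitian_fromBlocks_iff] at hsymm
  obtain ⟨h11, -, -, h22⟩ := hsymm
  refine ⟨L, ?_, ?_, hL, fun x u hxu => ?_⟩
  · have := h11.eq
    simp only [Matrix.conjTranspose_eq_transpose_of_trivial, Matrix.transpose_sub,
      Matrix.transpose_add, Matrix.transpose_mul, Matrix.transpose_transpose, hL.eq,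
      Matrix.mul_assoc] at this
    simpa [Matrix.IsSymm] using this
  · have := h22.eq
    simp only [Matrix.conjTranspose_eq_transpose_of_trivial, Matrix.transpose_sub,
      Matrix.transpose_mul, Matrix.transpose_transpose, hL.eq, Matrix.mul_assoc] at this
    simpa [Matrix.IsSymm] using this
  · have hne : Sum.elim x u ≠ 0 := by
      intro h0
      rcases hxu with hx | hu
      · exact hx (funext fun i => congrFun h0 (Sum.inl i))
      · exact hu (funext fun i => congrFun h0 (Sum.inr i))
    have h1 := hpos.dotProduct_mulVec_pos hne
    rw [star_trivial, rotatedH, Matrix.fromBlocks_mulVec, Sum.elim_comp_inl, Sum.elim_comp_inr,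
      sumElim_dotProduct_sumElim] at h1
    refine h1.trans_eq ?_
    rw [stageCost_eq, quadVal_add_right hL]
    simp only [quadVal, Matrix.add_mulVec, Matrix.sub_mulVec, Matrix.mul_assoc,
      ← Matrix.mulVec_mulVec, dotProduct_add, dotProduct_sub, dotProduct_transpose_mulVec]
    rw [dotProduct_comm (p.S *ᵥ x), hL.dotProduct_mulVec_comm (p.B *ᵥ u)]
    ring

/-- If `P + L` is positive semidefinite, then `R + Bᵀ P B` is positive definite. -/
theorem DissipatesWith.quadVal_inputHessian_pos {p : LQProblem n m}
    {L P : Matrix (Fin n) (Fin n) ℝ} (h : p.DissipatesWith L) (hP : ∀ x, 0 ≤ quadVal (P + L) x)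
    (u : Fin m → ℝ) (hu : u ≠ 0) : 0 < quadVal (p.R + p.Bᵀ * P * p.B) u := by
  have h1 := h.pos 0 u (Or.inr hu)
  have h2 := hP (p.B *ᵥ u)
  rw [stageCost_eq, Matrix.mulVec_zero, Matrix.mulVec_zero, zero_add] at h1
  rw [quadVal_add_left] at h2
  rw [quadVal_add_left, quadVal_congruence]
  simp at h1
  linarith

theorem DissipatesWith.isUnit_inputHessian {p : LQProblem n m}
    {L P : Matrix (Fin n) (Fin n) ℝ} (h : p.DissipatesWith L)
    (hP : ∀ x, 0 ≤ quadVal (P + L) x) : IsUnit (p.R + p.Bᵀ * P * p.B).det :=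
  isUnit_det_of_quadVal_ne_zero fun u hu => (h.quadVal_inputHessian_pos hP u hu).ne'

theorem closedLoop_eq (p : LQProblem n m) (K : Matrix (Fin m) (Fin n) ℝ) (x : Fin n → ℝ) :
    p.closedLoop K x = (p.A - p.B * K) *ᵥ x := by
  rw [closedLoop, Matrix.sub_mulVec, Matrix.mulVec_neg, Matrix.mulVec_mulVec, sub_eq_add_neg]

/-- Along the closed loop of any solution `P` of the DARE, the form of `P + L` strictly
decreases. -/
theorem DissipatesWith.quadVal_closedLoop_lt {p : LQProblem n m}
    {L P : Matrix (Fin n) (Fin n) ℝ} (h : p.DissipatesWith L) (hP : p.IsDARESolution P)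
    (x : Fin n → ℝ) (hx : x ≠ 0) :
    quadVal (P + L) ((p.A - p.B * p.gain P) *ᵥ x) < quadVal (P + L) x := by
  have h1 := h.pos x (-(p.gain P *ᵥ x)) (Or.inl hx)
  have h2 := hP.stageCost_add_quadVal h.isSymm_R x (-(p.gain P *ᵥ x))
  rw [neg_add_cancel, quadVal_zero] at h2
  rw [← closedLoop_eq, closedLoop, quadVal_add_left, quadVal_add_left]
  linarith

theorem DissipatesWith.quadVal_nonneg {p : LQProblem n m}
    {L P : Matrix (Fin n) (Fin n) ℝ} (h : p.DissipatesWith L) (hP : p.IsStabilizingSolution P)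
    (x : Fin n → ℝ) : 0 ≤ quadVal (P + L) x := by
  refine hP.2.quadVal_nonneg (fun y => ?_) x
  by_cases hy : y = 0
  · simp [hy]
  · exact (h.quadVal_closedLoop_lt hP.1 y hy).le

/-- The quadratic form of a stabilizing solution lies below that of any other one, since its
feedback is optimal among those that drive the state to zero. -/
theorem DissipatesWith.stabilizing_le {p : LQProblem n m}
    {L P P' : Matrix (Fin n) (Fin n) ℝ} (h : p.DissipatesWith L) (hP : p.IsStabilizingSolution P)
    (hP' : p.IsStabilizingSolution P') (x : Fin n → ℝ) : quadVal P x ≤ quadVal P' x := by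
  have h1 : 0 ≤ quadVal (P' - P) x := by
    refine hP'.2.quadVal_nonneg (fun y => ?_) x
    have h2 := hP.1.stageCost_add_quadVal h.isSymm_R y (-(p.gain P' *ᵥ y))
    have h3 := hP'.1.stageCost_add_quadVal h.isSymm_R y (-(p.gain P' *ᵥ y))
    have h4 := quadVal_nonneg_of_pos (h.quadVal_inputHessian_pos (h.quadVal_nonneg hP))
      (-(p.gain P' *ᵥ y) + p.gain P *ᵥ y)
    rw [neg_add_cancel, quadVal_zero] at h3
    rw [← closedLoop_eq, closedLoop, quadVal_sub_left, quadVal_sub_left]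
    linarith
  rw [quadVal_sub_left] at h1
  linarith

theorem DissipatesWith.stabilizing_unique {p : LQProblem n m}
    {L P P' : Matrix (Fin n) (Fin n) ℝ} (h : p.DissipatesWith L) (hP : p.IsStabilizingSolution P)
    (hP' : p.IsStabilizingSolution P') : P = P' :=
  hP.1.1.ext_quadVal hP'.1.1 fun x =>
    le_antisymm (h.stabilizing_le hP hP' x) (h.stabilizing_le hP' hP x)

/-! ### Existence of a stabilizing solution by value iteration -/

/-- The states that some finite control sequence steers to the origin. -/
inductive SteersToZero (p : LQProblem n m) : (Fin n → ℝ) → Prop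
  | zero : SteersToZero p 0
  | step (x : Fin n → ℝ) (u : Fin m → ℝ) :
      SteersToZero p (p.A *ᵥ x + p.B *ᵥ u) → SteersToZero p x

theorem _root_.ContinuousAt.matrix_mul {X : Type*} [TopologicalSpace X] {k l : ℕ}
    {f : X → Matrix (Fin n) (Fin k) ℝ} {g : X → Matrix (Fin k) (Fin l) ℝ} {x : X}
    (hf : ContinuousAt f x) (hg : ContinuousAt g x) : ContinuousAt (fun y => f y * g y) x :=
  ((continuous_fst.matrix_mul continuous_snd).tendsto (f x, g x)).comp (hf.prodMk_nhds hg)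

theorem continuousAt_gain (p : LQProblem n m) {P : Matrix (Fin n) (Fin n) ℝ}
    (hM : IsUnit (p.R + p.Bᵀ * P * p.B).det) : ContinuousAt p.gain P := by
  have h1 : Continuous fun P : Matrix (Fin n) (Fin n) ℝ => p.R + p.Bᵀ * P * p.B := by fun_prop
  have h2 : ContinuousAt
      (fun P : Matrix (Fin n) (Fin n) ℝ => (p.R + p.Bᵀ * P * p.B)⁻¹) P := by
    simp only [Matrix.inv_def, Ring.inverse_eq_inv']
    exact (h1.matrix_det.continuousAt.inv₀ hM.ne_zero).smul h1.matrix_adjugate.continuousAt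
  have h3 : Continuous fun P : Matrix (Fin n) (Fin n) ℝ => p.S + p.Bᵀ * P * p.A := by fun_prop
  exact h2.matrix_mul h3.continuousAt

theorem continuousAt_riccati (p : LQProblem n m) {P : Matrix (Fin n) (Fin n) ℝ}
    (hM : IsUnit (p.R + p.Bᵀ * P * p.B).det) : ContinuousAt p.riccati P := by
  have h1 : Continuous fun P : Matrix (Fin n) (Fin n) ℝ => p.Q + p.Aᵀ * P * p.A := by fun_prop
  have h2 : Continuous fun P : Matrix (Fin n) (Fin n) ℝ => p.Sᵀ + p.Aᵀ * P * p.B := by fun_prop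
  exact h1.continuousAt.sub (h2.continuousAt.matrix_mul (p.continuousAt_gain hM))

/-- One step of the minimization in the Bellman equation. -/
theorem DissipatesWith.riccati_le {p : LQProblem n m} {L P : Matrix (Fin n) (Fin n) ℝ}
    (h : p.DissipatesWith L) (hP : P.IsSymm) (hPL : ∀ x, 0 ≤ quadVal (P + L) x)
    (x : Fin n → ℝ) (u : Fin m → ℝ) :
    quadVal (p.riccati P) x ≤ p.stageCost x u + quadVal P (p.A *ᵥ x + p.B *ᵥ u) := by
  rw [stageCost_add_quadVal h.isSymm_R hP (h.isUnit_inputHessian hPL)]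
  exact le_add_of_nonneg_right (quadVal_nonneg_of_pos (h.quadVal_inputHessian_pos hPL) _)

theorem DissipatesWith.riccati_gain {p : LQProblem n m} {L P : Matrix (Fin n) (Fin n) ℝ}
    (h : p.DissipatesWith L) (hP : P.IsSymm) (hPL : ∀ x, 0 ≤ quadVal (P + L) x)
    (x : Fin n → ℝ) :
    quadVal (p.riccati P) x = p.stageCost x (-(p.gain P *ᵥ x))
      + quadVal P (p.A *ᵥ x + p.B *ᵥ (-(p.gain P *ᵥ x))) := by
  rw [stageCost_add_quadVal h.isSymm_R hP (h.isUnit_inputHessian hPL)]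
  simp

/-- Value iteration from `-L`, the smallest matrix for which the rotated terminal cost is
nonnegative. -/
noncomputable def valueIter (p : LQProblem n m) (L : Matrix (Fin n) (Fin n) ℝ) :
    ℕ → Matrix (Fin n) (Fin n) ℝ
  | 0 => -L
  | k + 1 => p.riccati (p.valueIter L k)

theorem DissipatesWith.rotatedCost_nonneg {p : LQProblem n m} {L : Matrix (Fin n) (Fin n) ℝ}
    (h : p.DissipatesWith L) (x : Fin n → ℝ) (u : Fin m → ℝ) :
    0 ≤ p.stageCost x u + quadVal L x - quadVal L (p.A *ᵥ x + p.B *ᵥ u) := by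
  by_cases hxu : x ≠ 0 ∨ u ≠ 0
  · exact (h.pos x u hxu).le
  · rw [not_or, not_not, not_not] at hxu
    rw [hxu.1, hxu.2, stageCost_eq]
    simp

theorem DissipatesWith.valueIter_spec {p : LQProblem n m} {L : Matrix (Fin n) (Fin n) ℝ}
    (h : p.DissipatesWith L) (k : ℕ) :
    (p.valueIter L k).IsSymm ∧ (∀ x, 0 ≤ quadVal (p.valueIter L k + L) x) ∧
      ∀ x, quadVal (p.valueIter L k) x ≤ quadVal (p.valueIter L (k + 1)) x := by
  induction k with
  | zero =>
    have hs : (p.valueIter L 0).IsSymm := h.isSymm.neg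
    have hn : ∀ x, 0 ≤ quadVal (p.valueIter L 0 + L) x := fun x => by
      simp [valueIter, quadVal]
    refine ⟨hs, hn, fun x => ?_⟩
    have h1 := h.riccati_gain hs hn x
    have h2 := h.rotatedCost_nonneg x (-(p.gain (p.valueIter L 0) *ᵥ x))
    change _ ≤ quadVal (p.riccati (p.valueIter L 0)) x
    rw [h1]
    simp only [valueIter, quadVal_neg_left] at h2 ⊢
    linarith
  | succ k ih =>
    obtain ⟨hs, hn, hm⟩ := ih
    have hs' : (p.valueIter L (k + 1)).IsSymm :=
      isSymm_riccati h.isSymm_Q h.isSymm_R hs (h.isUnit_inputHessian hn)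
    have hn' : ∀ x, 0 ≤ quadVal (p.valueIter L (k + 1) + L) x := fun x => by
      have h1 := hn x
      rw [quadVal_add_left] at h1 ⊢
      linarith [hm x]
    refine ⟨hs', hn', fun x => ?_⟩
    change quadVal (p.riccati (p.valueIter L k)) x
      ≤ quadVal (p.riccati (p.valueIter L (k + 1))) x
    rw [h.riccati_gain hs' hn' x]
    exact (h.riccati_le hs hn x _).trans (by gcongr; exact hm _)

theorem DissipatesWith.bddAbove_valueIter {p : LQProblem n m} {L : Matrix (Fin n) (Fin n) ℝ}
    (h : p.DissipatesWith L) {x : Fin n → ℝ} (hx : p.SteersToZero x) :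
    BddAbove (Set.range fun k => quadVal (p.valueIter L k) x) := by
  induction hx with
  | zero => exact ⟨0, by rintro _ ⟨k, rfl⟩; simp⟩
  | step x u _ ih =>
    obtain ⟨c, hc⟩ := ih
    refine ⟨p.stageCost x u + c, ?_⟩
    rintro _ ⟨k, rfl⟩
    obtain ⟨hs, hn, hm⟩ := h.valueIter_spec k
    have h1 := hc ⟨k, rfl⟩
    have h2 := h.riccati_le hs hn x u
    have h3 := hm x
    change _ ≤ quadVal (p.riccati (p.valueIter L k)) x at h3
    simp only at h1 ⊢
    linarith

theorem DissipatesWith.exists_stabilizing {p : LQProblem n m} {L : Matrix (Fin n) (Fin n) ℝ}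
    (h : p.DissipatesWith L) (hst : ∀ x, p.SteersToZero x) :
    ∃ P, p.IsStabilizingSolution P := by
  have hconv : ∀ x, ∃ c, Tendsto (fun k => quadVal (p.valueIter L k) x) atTop (𝓝 c) := fun x =>
    ⟨_, tendsto_atTop_ciSup (monotone_nat_of_le_succ fun k => (h.valueIter_spec k).2.2 x)
      (h.bddAbove_valueIter (hst x))⟩
  choose v hv using hconv
  obtain ⟨P, hP⟩ : ∃ P, Tendsto (p.valueIter L) atTop (𝓝 P) := by
    refine ⟨Matrix.of fun i j => (v (Pi.single i 1 + Pi.single j 1) - v (Pi.single i 1)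
      - v (Pi.single j 1)) / 2, ?_⟩
    refine tendsto_pi_nhds.mpr fun i => tendsto_pi_nhds.mpr fun j => ?_
    simp only [(h.valueIter_spec _).1.apply_eq_quadVal i j]
    exact (((hv _).sub (hv _)).sub (hv _)).div_const 2
  have hPs : P.IsSymm := by
    refine tendsto_nhds_unique ?_ hP
    have : Tendsto (fun k => (p.valueIter L k)ᵀ) atTop (𝓝 Pᵀ) :=
      (continuous_id.matrix_transpose.tendsto P).comp hP
    simpa only [(h.valueIter_spec _).1.eq] using this
  have hPn : ∀ x, 0 ≤ quadVal (P + L) x := fun x => by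
    have hc : Continuous fun P : Matrix (Fin n) (Fin n) ℝ => quadVal (P + L) x := by
      unfold quadVal
      fun_prop
    exact ge_of_tendsto' ((hc.tendsto P).comp hP) fun k => (h.valueIter_spec k).2.1 x
  have hM := h.isUnit_inputHessian hPn
  have hfix : p.riccati P = P :=
    tendsto_nhds_unique ((p.continuousAt_riccati hM).tendsto.comp hP)
      (hP.comp (tendsto_add_atTop_nat 1))
  have hD : p.IsDARESolution P := ⟨hPs, hM, hfix.symm⟩
  exact ⟨P, hD, isSchurStable_of_quadVal_lt (hPs.add h.isSymm) hPn
    (h.quadVal_closedLoop_lt hD)⟩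

/-! ### Controllability -/

/-- The states that can be reached from the origin in finitely many steps. -/
inductive Reachable (p : LQProblem n m) : (Fin n → ℝ) → Prop
  | zero : Reachable p 0
  | step (x : Fin n → ℝ) (u : Fin m → ℝ) :
      Reachable p x → Reachable p (p.A *ᵥ x + p.B *ᵥ u)

theorem Controllable.exists_eq_sum {p : LQProblem n m} (h : p.Controllable) (x : Fin n → ℝ) :
    ∃ c : ℕ → Fin m → ℝ, x = ∑ k ∈ Finset.range n, (p.A ^ k) *ᵥ (p.B *ᵥ c k) := by
  unfold Controllable at h
  set W := Matrix.of fun (i : Fin n) (kj : Fin n × Fin m) => (p.A ^ (kj.1 : ℕ) * p.B) i kj.2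
    with hW
  have hsurj : LinearMap.range W.mulVecLin = ⊤ := by
    apply Submodule.eq_top_of_finrank_eq
    rw [← Matrix.rank, h]
    simp
  obtain ⟨c, hc⟩ : ∃ c, W.mulVecLin c = x := by
    rw [← LinearMap.mem_range, hsurj]
    trivial
  refine ⟨fun k j => if hk : k < n then c (⟨k, hk⟩, j) else 0, ?_⟩
  rw [← hc, Finset.sum_range]
  ext i
  simp only [Matrix.mulVecLin_apply, Matrix.mulVec_mulVec, Finset.sum_apply]
  simp [Matrix.mulVec, dotProduct, hW, Fintype.sum_prod_type]

theorem reachable_sum (p : LQProblem n m) (j : ℕ) (c : ℕ → Fin m → ℝ) :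
    p.Reachable (∑ k ∈ Finset.range j, (p.A ^ k) *ᵥ (p.B *ᵥ c k)) := by
  induction j generalizing c with
  | zero => simpa using Reachable.zero
  | succ j ih =>
    have h := Reachable.step _ (c 0) (ih fun k => c (k + 1))
    rw [Finset.sum_range_succ', pow_zero, Matrix.one_mulVec]
    convert h using 2
    rw [Matrix.mulVec_sum]
    simp [pow_succ', Matrix.mulVec_mulVec, Matrix.mul_assoc]

theorem SteersToZero.of_pow_add_sum (p : LQProblem n m) (j : ℕ) (c : ℕ → Fin m → ℝ)
    (x : Fin n → ℝ)
    (h : p.SteersToZero ((p.A ^ j) *ᵥ x + ∑ k ∈ Finset.range j, (p.A ^ k) *ᵥ (p.B *ᵥ c k))) :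
    p.SteersToZero x := by
  induction j generalizing x with
  | zero => simpa using h
  | succ j ih =>
    refine .step x (c j) (ih _ ?_)
    convert h using 1
    rw [Finset.sum_range_succ, Matrix.mulVec_add, Matrix.mulVec_mulVec, ← pow_succ]
    abel

theorem Controllable.reachable {p : LQProblem n m} (h : p.Controllable) (x : Fin n → ℝ) :
    p.Reachable x := by
  obtain ⟨c, rfl⟩ := h.exists_eq_sum x
  exact p.reachable_sum n c

theorem Controllable.steersToZero {p : LQProblem n m} (h : p.Controllable) (x : Fin n → ℝ) :
    p.SteersToZero x := by
  obtain ⟨c, hc⟩ := h.exists_eq_sum (-((p.A ^ n) *ᵥ x))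
  refine .of_pow_add_sum p n c x ?_
  rw [← hc, add_neg_cancel]
  exact .zero

theorem Reachable.preFeedback {p : LQProblem n m} (Khat : Matrix (Fin m) (Fin n) ℝ)
    {x : Fin n → ℝ} (h : p.Reachable x) : (p.preFeedback Khat).Reachable x := by
  induction h with
  | zero => exact .zero
  | step x u _ ih =>
    convert Reachable.step x (u + Khat *ᵥ x) ih using 1
    simp only [LQProblem.preFeedback, Matrix.sub_mulVec, Matrix.mulVec_add, Matrix.mulVec_mulVec]
    abel

/-- Linear maps `f` and `g` whose ranges span the codomain admit `k` with `f - g k` injective: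
`k` sends `ker f` to inputs that represent `coker f`. -/
theorem exists_injective_sub_comp {V U : Type*} [AddCommGroup V] [Module ℝ V]
    [FiniteDimensional ℝ V] [AddCommGroup U] [Module ℝ U] (f : V →ₗ[ℝ] V) (g : U →ₗ[ℝ] V)
    (h : ∀ x, ∃ y u, f y + g u = x) :
    ∃ k : V →ₗ[ℝ] U, Function.Injective (f - g ∘ₗ k) := by
  have hdim : Module.finrank ℝ (LinearMap.ker f) = Module.finrank ℝ (V ⧸ LinearMap.range f) := by
    have h1 := f.finrank_range_add_finrank_ker
    have h2 := (LinearMap.range f).finrank_quotient_add_finrank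
    omega
  let φ := LinearEquiv.ofFinrankEq _ _ hdim
  set π := (LinearMap.range f).mkQ with hπ
  have hπf : ∀ y, π (f y) = 0 := fun y => by simp [hπ]
  have hsurj : LinearMap.range (π ∘ₗ g) = ⊤ := by
    rw [LinearMap.range_eq_top]
    intro q
    obtain ⟨x, rfl⟩ := (LinearMap.range f).mkQ_surjective q
    obtain ⟨y, u, rfl⟩ := h x
    exact ⟨u, by simp [← hπ, hπf]⟩
  obtain ⟨s, hs⟩ := (π ∘ₗ g).exists_rightInverse_of_surjective hsurj
  obtain ⟨r, hr⟩ := (LinearMap.ker f).subtype.exists_leftInverse_of_injective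
    (Submodule.ker_subtype _)
  refine ⟨s ∘ₗ φ.toLinearMap ∘ₗ r, ?_⟩
  rw [injective_iff_map_eq_zero]
  intro x hx
  have hx' : f x = g (s (φ (r x))) := by simpa [sub_eq_zero] using hx
  have h1 : φ (r x) = 0 := by
    have h2 := congrArg π hx'
    rw [hπf] at h2
    exact (LinearMap.congr_fun hs (φ (r x))).symm.trans h2.symm
  have h2 : r x = 0 := by simpa using h1
  have h3 : f x = 0 := by rw [hx', h1]; simp
  have h4 : r x = ⟨x, h3⟩ := LinearMap.congr_fun hr ⟨x, h3⟩
  rw [h2] at h4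
  exact (congrArg Subtype.val h4).symm

theorem Controllable.exists_isUnit_det {p : LQProblem n m} (h : p.Controllable) :
    ∃ Khat : Matrix (Fin m) (Fin n) ℝ, IsUnit (p.A - p.B * Khat).det := by
  obtain ⟨k, hk⟩ := exists_injective_sub_comp p.A.mulVecLin p.B.mulVecLin fun x => by
    cases h.reachable x with
    | zero => exact ⟨0, 0, by simp⟩
    | step y u _ => exact ⟨y, u, rfl⟩
  refine ⟨LinearMap.toMatrix' k, ?_⟩
  rw [← Matrix.isUnit_iff_isUnit_det, ← Matrix.mulVec_injective_iff_isUnit]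
  convert hk using 1
  ext x
  simp [Matrix.sub_mulVec, ← Matrix.mulVec_mulVec, LinearMap.toMatrix'_mulVec]

/-! ### Prefeedback, time reversal and negation -/

theorem stageCost_preFeedback {p : LQProblem n m} (hR : p.R.IsSymm)
    (Khat : Matrix (Fin m) (Fin n) ℝ) (x : Fin n → ℝ) (v : Fin m → ℝ) :
    (p.preFeedback Khat).stageCost x v = p.stageCost x (v - Khat *ᵥ x) := by
  rw [stageCost_eq, stageCost_eq, sub_eq_add_neg v, quadVal_add_right hR, quadVal_neg_right]
  have h1 : quadVal (p.Sᵀ * Khat) x = (Khat *ᵥ x) ⬝ᵥ (p.S *ᵥ x) := by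
    rw [quadVal, ← Matrix.mulVec_mulVec, dotProduct_transpose_mulVec, dotProduct_comm]
  have h2 : quadVal (Khatᵀ * p.S) x = (Khat *ᵥ x) ⬝ᵥ (p.S *ᵥ x) := by
    rw [quadVal, ← Matrix.mulVec_mulVec, dotProduct_transpose_mulVec]
  simp only [preFeedback, quadVal_add_left, quadVal_sub_left, quadVal_congruence, h1, h2,
    Matrix.sub_mulVec, ← Matrix.mulVec_mulVec, Matrix.mulVec_neg, dotProduct_sub, dotProduct_neg,
    add_dotProduct, neg_dotProduct]
  ring

theorem preFeedback_step (p : LQProblem n m) (Khat : Matrix (Fin m) (Fin n) ℝ) (x : Fin n → ℝ)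
    (v : Fin m → ℝ) :
    (p.preFeedback Khat).A *ᵥ x + (p.preFeedback Khat).B *ᵥ v
      = p.A *ᵥ x + p.B *ᵥ (v - Khat *ᵥ x) := by
  simp only [preFeedback, Matrix.sub_mulVec, Matrix.mulVec_sub, Matrix.mulVec_mulVec]
  abel

theorem DissipatesWith.preFeedback {p : LQProblem n m} {L : Matrix (Fin n) (Fin n) ℝ}
    (h : p.DissipatesWith L) (Khat : Matrix (Fin m) (Fin n) ℝ) :
    (p.preFeedback Khat).DissipatesWith L := by
  refine ⟨?_, h.isSymm_R, h.isSymm, fun x v hxv => ?_⟩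
  · simp only [LQProblem.preFeedback, Matrix.IsSymm, Matrix.transpose_add, Matrix.transpose_sub,
      Matrix.transpose_mul, Matrix.transpose_transpose, h.isSymm_Q.eq, h.isSymm_R.eq,
      Matrix.mul_assoc]
    abel
  · rw [stageCost_preFeedback h.isSymm_R, preFeedback_step]
    refine h.pos x _ ?_
    by_cases hx : x = 0
    · subst hx
      simpa using hxv
    · exact Or.inl hx

/-- The problem with the opposite stage cost. -/
def neg (p : LQProblem n m) : LQProblem n m where
  A := p.A
  B := p.B
  Q := -p.Q
  S := -p.S
  R := -p.R

theorem neg_neg (p : LQProblem n m) : p.neg.neg = p := by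
  simp [neg]

theorem stageCost_neg (p : LQProblem n m) (x : Fin n → ℝ) (u : Fin m → ℝ) :
    p.neg.stageCost x u = -p.stageCost x u := by
  simp only [stageCost_eq, neg, quadVal_neg_left, Matrix.neg_mulVec, dotProduct_neg]
  ring

theorem inputHessian_neg (p : LQProblem n m) (P : Matrix (Fin n) (Fin n) ℝ) :
    p.neg.R + p.neg.Bᵀ * (-P) * p.neg.B = -(p.R + p.Bᵀ * P * p.B) := by
  simp only [neg, Matrix.mul_neg, Matrix.neg_mul, neg_add]

theorem IsStabilizingSolution.neg {p : LQProblem n m} {P : Matrix (Fin n) (Fin n) ℝ}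
    (h : p.IsStabilizingSolution P) : p.neg.IsStabilizingSolution (-P) := by
  obtain ⟨⟨hs, hM, hP⟩, hst⟩ := h
  have hg : p.neg.gain (-P) = p.gain P := by
    rw [gain, inputHessian_neg, gain]
    have hinv : (-(p.R + p.Bᵀ * P * p.B))⁻¹ = -(p.R + p.Bᵀ * P * p.B)⁻¹ :=
      Matrix.inv_eq_left_inv (by rw [neg_mul_neg, Matrix.nonsing_inv_mul _ hM])
    rw [hinv]
    simp only [LQProblem.neg, Matrix.mul_neg, Matrix.neg_mul, ← neg_add, _root_.neg_neg]
  refine ⟨⟨hs.neg, ?_, ?_⟩, ?_⟩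
  · rw [inputHessian_neg, Matrix.det_neg]
    exact ((isUnit_neg_one).pow _).mul hM
  · rw [hg]
    conv_lhs => rw [hP]
    simp only [LQProblem.neg, Matrix.mul_neg, Matrix.neg_mul, Matrix.transpose_neg]
    rw [← neg_add, ← neg_add, Matrix.neg_mul]
    abel
  · rw [hg]
    exact hst

theorem reverse_step {p : LQProblem n m} (hA : IsUnit p.A.det) (z : Fin n → ℝ) (v : Fin m → ℝ) :
    p.A *ᵥ (p.reverse.A *ᵥ z + p.reverse.B *ᵥ v) + p.B *ᵥ (-v) = z := by
  simp only [reverse, Matrix.mulVec_add, Matrix.mulVec_mulVec, Matrix.mulVec_neg]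
  rw [← Matrix.mul_assoc, Matrix.mul_nonsing_inv _ hA]
  simp

theorem reverse_step_step {p : LQProblem n m} (hA : IsUnit p.A.det) (x : Fin n → ℝ)
    (u : Fin m → ℝ) :
    p.reverse.A *ᵥ (p.A *ᵥ x + p.B *ᵥ u) + p.reverse.B *ᵥ (-u) = x := by
  simp only [reverse, Matrix.mulVec_add, Matrix.mulVec_mulVec, Matrix.mulVec_neg]
  rw [Matrix.nonsing_inv_mul _ hA]
  simp

theorem stageCost_reverse {p : LQProblem n m} (hQ : p.Q.IsSymm) (z : Fin n → ℝ)
    (v : Fin m → ℝ) :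
    p.reverse.stageCost z v
      = -p.stageCost (p.reverse.A *ᵥ z + p.reverse.B *ᵥ v) (-v) := by
  rw [stageCost_eq, stageCost_eq, quadVal_add_right hQ, quadVal_neg_right]
  simp only [reverse]
  set b := p.A⁻¹ * p.B
  have h1 : quadVal (bᵀ * p.Sᵀ) v = v ⬝ᵥ (p.S *ᵥ (b *ᵥ v)) := by
    rw [quadVal, ← Matrix.mulVec_mulVec, dotProduct_transpose_mulVec, dotProduct_transpose_mulVec,
      dotProduct_comm]
  have h2 : quadVal (p.S * b) v = v ⬝ᵥ (p.S *ᵥ (b *ᵥ v)) := by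
    rw [quadVal, ← Matrix.mulVec_mulVec]
  have h3 : v ⬝ᵥ ((bᵀ * p.Q * p.A⁻¹) *ᵥ z) = (p.A⁻¹ *ᵥ z) ⬝ᵥ (p.Q *ᵥ (b *ᵥ v)) := by
    rw [Matrix.mul_assoc, ← Matrix.mulVec_mulVec z bᵀ, dotProduct_transpose_mulVec,
      ← Matrix.mulVec_mulVec z p.Q, hQ.dotProduct_mulVec_comm]
  simp only [quadVal_add_left, quadVal_sub_left, quadVal_neg_left, quadVal_congruence, h1, h2,
    Matrix.sub_mulVec, dotProduct_sub, h3, Matrix.mulVec_add, dotProduct_add, neg_dotProduct]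
  rw [← Matrix.mulVec_mulVec]
  ring

/-- Running the dynamics backwards exchanges the two storage terms, so that the backward problem,
whose cost is again the original one, dissipates with the opposite storage function. -/
theorem DissipatesWith.reverse_neg {p : LQProblem n m} {L : Matrix (Fin n) (Fin n) ℝ}
    (h : p.DissipatesWith L) (hA : IsUnit p.A.det) : p.reverse.neg.DissipatesWith (-L) := by
  refine ⟨?_, ?_, h.isSymm.neg, fun z v hzv => ?_⟩
  · simp only [LQProblem.neg, LQProblem.reverse, Matrix.IsSymm, Matrix.transpose_neg,
      Matrix.transpose_mul, Matrix.transpose_transpose, h.isSymm_Q.eq, Matrix.mul_assoc]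
  · simp only [LQProblem.neg, LQProblem.reverse, Matrix.IsSymm, Matrix.transpose_neg,
      Matrix.transpose_sub, Matrix.transpose_add,
      Matrix.transpose_mul, Matrix.transpose_transpose, h.isSymm_Q.eq, h.isSymm_R.eq,
      Matrix.mul_assoc]
    abel
  · have hstep := reverse_step hA z v
    rw [stageCost_neg, stageCost_reverse h.isSymm_Q]
    change 0 < - -p.stageCost _ _ + _ - quadVal (-L) (p.reverse.A *ᵥ z + p.reverse.B *ᵥ v)
    set x := p.reverse.A *ᵥ z + p.reverse.B *ᵥ v
    have hx : x ≠ 0 ∨ -v ≠ 0 := by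
      by_contra! hc
      rw [hc.1, hc.2] at hstep
      rcases hzv with hz | hv
      · exact hz (by simpa using hstep.symm)
      · exact hv (neg_eq_zero.mp hc.2)
    have h1 := h.pos x (-v) hx
    rw [hstep] at h1
    rw [quadVal_neg_left, quadVal_neg_left]
    linarith

theorem Reachable.steersToZero_reverse_neg {p : LQProblem n m} (hA : IsUnit p.A.det)
    {x : Fin n → ℝ} (h : p.Reachable x) : p.reverse.neg.SteersToZero x := by
  induction h with
  | zero => exact .zero
  | step x u _ ih =>
    refine .step _ (-u) ?_
    change p.reverse.neg.SteersToZero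
      (p.reverse.A *ᵥ (p.A *ᵥ x + p.B *ᵥ u) + p.reverse.B *ᵥ (-u))
    rwa [reverse_step_step hA]

/-! ### The infinite-horizon cost -/

theorem state_succ (p : LQProblem n m) (x₀ : Fin n → ℝ) (u : ℕ → Fin m → ℝ) (k : ℕ) :
    p.state x₀ u (k + 1) = p.A *ᵥ p.state x₀ u k + p.B *ᵥ u k := rfl

/-- Summation of a telescoping expression for the stage cost. -/
theorem cost_eq_of_stageCost_eq {p : LQProblem n m} {Pf P : Matrix (Fin n) (Fin n) ℝ}
    {x₀ : Fin n → ℝ} {u : ℕ → Fin m → ℝ} {d : ℕ → ℝ}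
    (h : ∀ k, p.stageCost (p.state x₀ u k) (u k) = quadVal P (p.state x₀ u k)
      - quadVal P (p.state x₀ u (k + 1)) + d k) (N : ℕ) :
    p.cost Pf x₀ u N = quadVal P x₀ + ∑ k ∈ Finset.range N, d k
      + quadVal (Pf - P) (p.state x₀ u N) := by
  have h1 : p.cost Pf x₀ u N = ∑ k ∈ Finset.range N, p.stageCost (p.state x₀ u k) (u k)
      + quadVal Pf (p.state x₀ u N) := rfl
  rw [h1, Finset.sum_congr rfl fun k _ => h k, Finset.sum_add_distrib, Finset.sum_range_sub',
    quadVal_sub_left]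
  change quadVal P x₀ - _ + _ + _ = _
  ring

/-- The cost in terms of a solution of the DARE. -/
theorem IsDARESolution.cost_eq {p : LQProblem n m} {P : Matrix (Fin n) (Fin n) ℝ}
    (h : p.IsDARESolution P) (hR : p.R.IsSymm) (Pf : Matrix (Fin n) (Fin n) ℝ) (x₀ : Fin n → ℝ)
    (u : ℕ → Fin m → ℝ) (N : ℕ) :
    p.cost Pf x₀ u N = quadVal P x₀ + ∑ k ∈ Finset.range N,
        quadVal (p.R + p.Bᵀ * P * p.B) (u k + p.gain P *ᵥ p.state x₀ u k)
      + quadVal (Pf - P) (p.state x₀ u N) := by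
  refine cost_eq_of_stageCost_eq (fun k => ?_) N
  have := h.stageCost_add_quadVal hR (p.state x₀ u k) (u k)
  rw [← state_succ] at this
  linarith

/-- Written with the stabilizing solution of the RDARE, the cost is a constant plus nonnegative
increments plus the form of `E` at the terminal state. A bound on the cost along a subsequence of
horizons therefore bounds the terminal states along it and makes the increments summable; the state,
solved backwards in time by the Schur stable closed loop of the RDARE, then tends to zero. -/
theorem DissipatesWith.tendsto_state_zero {p : LQProblem n m}
    {L Pbar E : Matrix (Fin n) (Fin n) ℝ} {Khat : Matrix (Fin m) (Fin n) ℝ}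
    (h : p.DissipatesWith L) (hA : IsUnit (p.A - p.B * Khat).det)
    (hPbar : (p.preFeedback Khat).reverse.IsStabilizingSolution Pbar)
    (hE : ∀ x, x ≠ 0 → 0 < quadVal E x) {x₀ : Fin n → ℝ} {u : ℕ → Fin m → ℝ} {C : ℝ}
    (hC : ∃ᶠ N in atTop, p.cost (Pbar + E) x₀ u N ≤ C) :
    Tendsto (p.state x₀ u) atTop (𝓝 0) := by
  have hd := h.preFeedback Khat
  have hr := hd.reverse_neg hA
  set q := (p.preFeedback Khat).reverse with hq
  have hqR : q.R.IsSymm := by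
    have := hr.isSymm_R.neg
    rwa [neg, _root_.neg_neg] at this
  set x := p.state x₀ u with hx
  set M := -(q.R + q.Bᵀ * Pbar * q.B) with hM
  have hMpos : ∀ w, w ≠ 0 → 0 < quadVal M w := fun w hw => by
    have := hr.quadVal_inputHessian_pos (hr.quadVal_nonneg hPbar.neg) w hw
    rwa [inputHessian_neg] at this
  have hMnn : ∀ w, 0 ≤ quadVal M w := quadVal_nonneg_of_pos hMpos
  have hEnn : ∀ w, 0 ≤ quadVal E w := quadVal_nonneg_of_pos hE
  -- The input of the backward problem, and its deviation from the backward feedback law.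
  set v : ℕ → Fin m → ℝ := fun k => -(u k + Khat *ᵥ x k) with hv
  set w : ℕ → Fin m → ℝ := fun k => v k + q.gain Pbar *ᵥ x (k + 1) with hw
  have hback : ∀ k, q.A *ᵥ x (k + 1) + q.B *ᵥ v k = x k := fun k => by
    have h1 := reverse_step_step (p := p.preFeedback Khat) hA (x k) (u k + Khat *ᵥ x k)
    rw [preFeedback_step, add_sub_cancel_right] at h1
    exact h1
  have hrec : ∀ k, x k = (q.A - q.B * q.gain Pbar) *ᵥ x (k + 1) + q.B *ᵥ w k := fun k => by
    conv_lhs => rw [← hback k]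
    simp only [hw, Matrix.sub_mulVec, Matrix.mulVec_add, Matrix.mulVec_mulVec]
    abel
  have hstage : ∀ k, p.stageCost (x k) (u k)
      = quadVal Pbar (x k) - quadVal Pbar (x (k + 1)) + quadVal M (w k) := fun k => by
    have h1 := hPbar.1.stageCost_add_quadVal hqR (x (k + 1)) (v k)
    rw [hq, stageCost_reverse hd.isSymm_Q, ← hq, hback, hv] at h1
    simp only [_root_.neg_neg] at h1
    rw [stageCost_preFeedback h.isSymm_R, add_sub_cancel_right] at h1
    rw [hM, quadVal_neg_left]
    linarith
  have hcost := cost_eq_of_stageCost_eq (Pf := Pbar + E) hstage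
  simp only [add_sub_cancel_left] at hcost
  have hsum : Summable fun k => quadVal M (w k) := by
    refine summable_of_sum_range_le (c := C - quadVal Pbar x₀) (fun k => hMnn _) fun k => ?_
    obtain ⟨N, hN, hkN⟩ := (hC.and_eventually (eventually_ge_atTop k)).exists
    have h1 := Finset.sum_le_sum_of_subset_of_nonneg (Finset.range_mono hkN)
      fun i _ _ => hMnn (w i)
    rw [hcost] at hN
    linarith [hEnn (p.state x₀ u N)]
  have hw0 : Tendsto w atTop (𝓝 0) :=
    tendsto_zero_of_tendsto_quadVal hMpos hsum.tendsto_atTop_zero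
  have he : Tendsto (fun k => q.B *ᵥ w k) atTop (𝓝 0) := by
    have hc : Continuous fun y : Fin m → ℝ => q.B *ᵥ y := by fun_prop
    have := (hc.tendsto 0).comp hw0
    rwa [Matrix.mulVec_zero] at this
  obtain ⟨c, hc, hcE⟩ := exists_pos_mul_sq_norm_le_quadVal hE
  refine hPbar.2.tendsto_zero_of_backward hrec he
    (C := √((C - quadVal Pbar x₀) / c)) (hC.mono fun N hN => ?_)
  refine Real.le_sqrt_of_sq_le ?_
  rw [le_div_iff₀ hc, mul_comm]
  refine (hcE _).trans ?_
  rw [hcost] at hN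
  linarith [Finset.sum_nonneg fun k (_ : k ∈ Finset.range N) => hMnn (w k)]

theorem feedbackControl_state (p : LQProblem n m) (K : Matrix (Fin m) (Fin n) ℝ)
    (x₀ : Fin n → ℝ) (k : ℕ) :
    p.state x₀ (p.feedbackControl K x₀) k = (p.closedLoop K)^[k] x₀ := by
  induction k with
  | zero => rfl
  | succ k ih => rw [state_succ, ih, Function.iterate_succ_apply']; rfl

theorem eq_feedbackControl {p : LQProblem n m} {K : Matrix (Fin m) (Fin n) ℝ}
    {x₀ : Fin n → ℝ} {u : ℕ → Fin m → ℝ} (h : ∀ k, u k + K *ᵥ p.state x₀ u k = 0) :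
    u = p.feedbackControl K x₀ := by
  have hu : ∀ k, u k = -(K *ᵥ p.state x₀ u k) := fun k => eq_neg_of_add_eq_zero_left (h k)
  have hs : ∀ k, p.state x₀ u k = (p.closedLoop K)^[k] x₀ := by
    intro k
    induction k with
    | zero => rfl
    | succ k ih => rw [state_succ, hu, ih, Function.iterate_succ_apply']; rfl
  funext k
  rw [hu, hs]
  rfl

theorem closedLoop_iterate (p : LQProblem n m) (K : Matrix (Fin m) (Fin n) ℝ) (k : ℕ)
    (x : Fin n → ℝ) : (p.closedLoop K)^[k] x = ((p.A - p.B * K) ^ k) *ᵥ x := by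
  induction k with
  | zero => simp
  | succ k ih =>
    rw [Function.iterate_succ_apply', ih, closedLoop_eq, pow_succ', Matrix.mulVec_mulVec]

theorem isGloballyAsymptoticallyStable_closedLoop {p : LQProblem n m}
    {K : Matrix (Fin m) (Fin n) ℝ} (h : IsSchurStable (p.A - p.B * K)) :
    IsGloballyAsymptoticallyStable (p.closedLoop K) := by
  obtain ⟨a, ha, ha0, hb⟩ := h.exists_summable_bound
  have hS : 0 ≤ ∑' k, a k := tsum_nonneg ha0
  refine ⟨by simp [closedLoop_eq], fun ε hε => ⟨ε / (∑' k, a k + 1), by positivity,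
    fun x hx k => ?_⟩, fun x => ?_⟩
  · rw [closedLoop_iterate]
    calc _ ≤ a k * ‖x‖ := hb k x
      _ ≤ (∑' k, a k + 1) * ‖x‖ := by
        gcongr
        linarith [ha.le_tsum k fun i _ => ha0 i]
      _ < ε := by rwa [lt_div_iff₀' (by positivity)] at hx
  · simpa only [closedLoop_iterate] using h.tendsto_pow_mulVec x

section Optimality

variable {p : LQProblem n m} {L Ps Pbar E : Matrix (Fin n) (Fin n) ℝ}
  {Khat : Matrix (Fin m) (Fin n) ℝ}

theorem IsStabilizingSolution.tendsto_cost (hPs : p.IsStabilizingSolution Ps) (hR : p.R.IsSymm)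
    (Pf : Matrix (Fin n) (Fin n) ℝ) (x₀ : Fin n → ℝ) :
    Tendsto (p.cost Pf x₀ (p.feedbackControl (p.gain Ps) x₀)) atTop (𝓝 (quadVal Ps x₀)) := by
  have hcost : p.cost Pf x₀ (p.feedbackControl (p.gain Ps) x₀) = fun N => quadVal Ps x₀
      + quadVal (Pf - Ps) (((p.A - p.B * p.gain Ps) ^ N) *ᵥ x₀) := by
    funext N
    rw [hPs.1.cost_eq hR, feedbackControl_state, closedLoop_iterate, Finset.sum_eq_zero, add_zero]
    intro k _
    rw [feedbackControl_state, feedbackControl, neg_add_cancel, quadVal_zero]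
  rw [hcost]
  simpa using (((continuous_quadVal (Pf - Ps)).tendsto 0).comp
    (hPs.2.tendsto_pow_mulVec x₀)).const_add (quadVal Ps x₀)

/-- Asymptotically, every control sequence costs at least as much as the stabilizing feedback plus
the penalty for any single deviation from it: otherwise the cost is bounded along a subsequence, so
the state tends to zero and the terminal term vanishes in the limit. -/
theorem DissipatesWith.eventually_lt_cost (h : p.DissipatesWith L)
    (hPs : p.IsStabilizingSolution Ps) (hA : IsUnit (p.A - p.B * Khat).det)
    (hPbar : (p.preFeedback Khat).reverse.IsStabilizingSolution Pbar)
    (hE : ∀ x, x ≠ 0 → 0 < quadVal E x) (x₀ : Fin n → ℝ) (u : ℕ → Fin m → ℝ) (k : ℕ) {c : ℝ}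
    (hc : c < quadVal Ps x₀
      + quadVal (p.R + p.Bᵀ * Ps * p.B) (u k + p.gain Ps *ᵥ p.state x₀ u k)) :
    ∀ᶠ N in atTop, c < p.cost (Pbar + E) x₀ u N := by
  by_contra hev
  have hfreq : ∃ᶠ N in atTop, p.cost (Pbar + E) x₀ u N ≤ c := by
    simpa only [Filter.not_eventually, not_lt] using hev
  have hx := h.tendsto_state_zero hA hPbar hE hfreq
  have hterm := ((continuous_quadVal (Pbar + E - Ps)).tendsto 0).comp hx
  rw [quadVal_zero] at hterm
  have hM : ∀ w, 0 ≤ quadVal (p.R + p.Bᵀ * Ps * p.B) w :=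
    quadVal_nonneg_of_pos (h.quadVal_inputHessian_pos (h.quadVal_nonneg hPs))
  obtain ⟨N, hN, hkN, hN'⟩ := (hfreq.and_eventually ((eventually_gt_atTop k).and
    (hterm.eventually_const_lt (sub_neg.mpr hc)))).exists
  have h1 := Finset.single_le_sum
    (f := fun k => quadVal (p.R + p.Bᵀ * Ps * p.B) (u k + p.gain Ps *ᵥ p.state x₀ u k))
    (fun i _ => hM _) (Finset.mem_range.mpr hkN)
  rw [hPs.1.cost_eq h.isSymm_R] at hN
  simp only [Function.comp_apply] at h1 hN'
  linarith

theorem DissipatesWith.isOptimalControl_iff (h : p.DissipatesWith L)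
    (hPs : p.IsStabilizingSolution Ps) (hA : IsUnit (p.A - p.B * Khat).det)
    (hPbar : (p.preFeedback Khat).reverse.IsStabilizingSolution Pbar)
    (hE : ∀ x, x ≠ 0 → 0 < quadVal E x) (x₀ : Fin n → ℝ) (u : ℕ → Fin m → ℝ) :
    p.IsOptimalControl (Pbar + E) x₀ u ↔ u = p.feedbackControl (p.gain Ps) x₀ := by
  have hM := h.quadVal_inputHessian_pos (h.quadVal_nonneg hPs)
  have hM0 : ∀ w, 0 ≤ quadVal (p.R + p.Bᵀ * Ps * p.B) w := quadVal_nonneg_of_pos hM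
  have hfb : Tendsto
      (fun N => (p.cost (Pbar + E) x₀ (p.feedbackControl (p.gain Ps) x₀) N : EReal)) atTop
      (𝓝 (quadVal Ps x₀ : EReal)) :=
    (continuous_coe_real_ereal.tendsto _).comp (hPs.tendsto_cost h.isSymm_R _ x₀)
  constructor
  · rintro ⟨v, hv, hopt⟩
    have hvle : v ≤ (quadVal Ps x₀ : EReal) := (hopt _).trans_eq hfb.liminf_eq
    refine eq_feedbackControl fun k => ?_
    by_contra hk
    obtain ⟨c, hc, hc'⟩ := exists_between (lt_add_of_pos_right (quadVal Ps x₀) (hM _ hk))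
    have h1 := h.eventually_lt_cost hPs hA hPbar hE x₀ u k hc'
    have h2 : (c : EReal) ≤ v :=
      ge_of_tendsto hv (h1.mono fun N hN => EReal.coe_le_coe_iff.mpr hN.le)
    exact absurd (h2.trans hvle) (not_le.mpr (EReal.coe_lt_coe_iff.mpr hc))
  · rintro rfl
    refine ⟨_, hfb, fun u' => ?_⟩
    refine le_of_forall_lt fun b hb => ?_
    obtain ⟨c, hbc, hc⟩ := EReal.lt_iff_exists_real_btwn.mp hb
    refine hbc.trans_le (le_liminf_of_le (by isBoundedDefault) ?_)
    refine (h.eventually_lt_cost hPs hA hPbar hE x₀ u' 0 (c := c) ?_).mono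
      fun N hN => EReal.coe_le_coe_iff.mpr hN.le
    exact (EReal.coe_lt_coe_iff.mp hc).trans_le (le_add_of_nonneg_right (hM0 _))

end Optimality

end LQProblem

theorem mainTheorem2 {n m : ℕ} (p : LQProblem n m)
    (hctrl : p.Controllable) (hdiss : p.StrictlyPreDissipative) :
    (∃ Khat : Matrix (Fin m) (Fin n) ℝ, IsUnit (p.A - p.B * Khat).det) ∧
    (∃! Ps : Matrix (Fin n) (Fin n) ℝ, p.IsStabilizingSolution Ps) ∧
    ∀ Khat : Matrix (Fin m) (Fin n) ℝ, IsUnit (p.A - p.B * Khat).det →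
      (∃! Pbar : Matrix (Fin n) (Fin n) ℝ,
        (p.preFeedback Khat).reverse.IsStabilizingSolution Pbar) ∧
      ∀ Ps Pbar E : Matrix (Fin n) (Fin n) ℝ,
        p.IsStabilizingSolution Ps →
        (p.preFeedback Khat).reverse.IsStabilizingSolution Pbar →
        E.PosDef →
        (∀ x₀ : Fin n → ℝ,
          (∀ u : ℕ → Fin m → ℝ,
            p.IsOptimalControl (Pbar + E) x₀ u ↔ u = p.feedbackControl (p.gain Ps) x₀) ∧
          Tendsto (p.cost (Pbar + E) x₀ (p.feedbackControl (p.gain Ps) x₀)) atTop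
            (𝓝 (x₀ ⬝ᵥ (Ps *ᵥ x₀)))) ∧
        IsGloballyAsymptoticallyStable (p.closedLoop (p.gain Ps)) := by
  obtain ⟨L, h⟩ := hdiss.exists_dissipatesWith
  refine ⟨hctrl.exists_isUnit_det, ?_, fun Khat hA => ⟨?_, ?_⟩⟩
  · obtain ⟨P, hP⟩ := h.exists_stabilizing hctrl.steersToZero
    exact ⟨P, hP, fun P' hP' => h.stabilizing_unique hP' hP⟩
  · have hr := (h.preFeedback Khat).reverse_neg hA
    obtain ⟨W, hW⟩ := hr.exists_stabilizing fun x =>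
      ((hctrl.reachable x).preFeedback Khat).steersToZero_reverse_neg hA
    have hW' := hW.neg
    rw [LQProblem.neg_neg] at hW'
    exact ⟨-W, hW', fun P' hP' => neg_eq_iff_eq_neg.mp (hr.stabilizing_unique hP'.neg hW)⟩
  · intro Ps Pbar E hPs hPbar hE
    have hEpos : ∀ x, x ≠ 0 → 0 < quadVal E x := fun x hx => by
      simpa [quadVal] using hE.dotProduct_mulVec_pos hx
    exact ⟨fun x₀ => ⟨h.isOptimalControl_iff hPs hA hPbar hEpos x₀,
      hPs.tendsto_cost h.isSymm_R _ x₀⟩, LQProblem.isGloballyAsymptoticallyStable_closedLoop hPs.2⟩
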